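/- Let $r\ge 0$ and let $\lambda=\mu/\nu=(\mu^{(1)}/\nu^{(1)},\dots,\mu^{(r)}/\nu^{(r)})$ be an $r$-skew shape, i.e. $\mu^{(i)},\nu^{(i)}$ are partitions (Young diagrams, drawn with matrix conventions) with $\nu^{(i)}\subseteq\mu^{(i)}$ for all $i$; the case where all $\nu^{(i)}=\emptyset$ is that of $r$-partitions. Assume that $\lambda$ has $n\ge 1$ boxes. Let $F$ be any field, and work in the field of rational functions over $F$ in independent indeterminates $q$ and $x_b$ ($b$ a box of $\lambda$). Let $\mathcal L(\lambda)$ be the set of standard tableaux of shape $\lambda$, i.e. bijective fillings of the boxes of $\lambda$ with $1,\dots,n$ that increase from left to right along the rows and from top to bottom down the columns of each $\mu^{(i)}/\nu^{(i)}$; $T(j)$ denotes the box containing $j$ in $T$. For $k\ge 0$ put $$\Delta^{(k)}(T)=x_{T(1)}^{\,k}\prod_{i=2}^{n}\frac{q-q^{-1}}{1-x_{T(i-1)}x_{T(i)}^{-1}} .$$ Let $D$, $R$, $C$ be the sets of pairs $(a,b)$ of boxes of $\lambda$, in the same $\mu^{(i)}/\nu^{(i)}$, such that $b$ is, respectively,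 immediately southeast, immediately east (in the same row), immediately south (in the same column) of $a$, and put $$\Pi=\Bigl(\prod_{(a,b)\in D}\frac{1-x_ax_b^{-1}}{q-q^{-1}}\Bigr)\Bigl(\prod_{(a,b)\in R}\frac{q-q^{-1}}{1-x_ax_b^{-1}}\Bigr)\Bigl(\prod_{(a,b)\in C}\frac{q-q^{-1}}{1-x_ax_b^{-1}}\Bigr).$$ Let $cc$ be the number of connected components of $\lambda$, where boxes of the same $\mu^{(i)}/\nu^{(i)}$ that share a side are joined; let $SC$ be the set of sharp corners (boxes of $\lambda$ with no box of $\lambda$ immediately above and none immediately to the left), and $DC$ the set of dull corners (boxes with a box of $\lambda$ immediately above and one immediately to the left, but none immediately northwest). Then $$\sum_{T\in\mathcal L(\lambda)}\Delta^{(0)}(T)=(q-q^{-1})^{cc-1}\,\Pi ,$$ and, for every $k\ge 1$, $$\sum_{T\in\mathcal L(\lambda)}\Delta^{(k)}(T)=(-q+q^{-1})^{cc-1}\Bigl(\prod_{s\in SC}x_s\Bigr)\Bigl(\prod_{d\in DC}x_d^{-1}\Bigr)\Bigl(\sum_{t=0}^{|DC|}(-1)^t e_t(x_{DC})\,h_{k-t-cc}(x_{SC})\Bigr)\,\Pi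 ,$$ where $e_t(x_{DC})$ is the $t$-th elementary symmetric function in the variables $x_d$, $d\in DC$, and $h_m(x_{SC})$ is the $m$-th complete homogeneous symmetric function in the variables $x_s$, $s\in SC$ (with $h_0=1$ and $h_m=0$ for $m<0$). -/

import Mathlib

/-- An `r`-skew shape `μ/ν`: two `r`-tuples of Young diagrams with `ν⁽ⁱ⁾ ⊆ μ⁽ⁱ⁾` for all `i`.
The `r`-partitions are the shapes all of whose inner diagrams are empty. -/
structure SkewShape (r : ℕ) where
  outer : Fin r → YoungDiagram
  inner : Fin r → YoungDiagram
  inner_le_outer : ∀ i, inner i ≤ outer i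

namespace SkewShape

variable {r : ℕ}

/-- A box of the shape: the index of one of the `r` diagrams, and a cell
`(row, column)` of the outer diagram that is not in the inner one. -/
abbrev Box (S : SkewShape r) : Type :=
  Σ i : Fin r, {c : ℕ × ℕ // c ∈ (S.outer i).cells \ (S.inner i).cells}

/-- The row of a box, counted from the top (matrix convention). -/
def row {S : SkewShape r} (b : S.Box) : ℕ := b.2.1.1

/-- The column of a box, counted from the left (matrix convention). -/
def col {S : SkewShape r} (b : S.Box) : ℕ := b.2.1.2

/-- The number `n` of boxes of the shape. -/
def size (S : SkewShape r) : ℕ := Fintype.card S.Box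

/-- `b` is the box immediately to the right (east) of `a`. -/
def RowAdj {S : SkewShape r} (a b : S.Box) : Prop :=
  a.1 = b.1 ∧ row b = row a ∧ col b = col a + 1

/-- `b` is the box immediately below (south of) `a`. -/
def ColAdj {S : SkewShape r} (a b : S.Box) : Prop :=
  a.1 = b.1 ∧ row b = row a + 1 ∧ col b = col a

/-- `b` is the box immediately southeast of `a`. -/
def DiagAdj {S : SkewShape r} (a b : S.Box) : Prop :=
  a.1 = b.1 ∧ row b = row a + 1 ∧ col b = col a + 1

instance {S : SkewShape r} : DecidableRel (RowAdj (S := S)) := fun a b =>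
  inferInstanceAs (Decidable (a.1 = b.1 ∧ row b = row a ∧ col b = col a + 1))

instance {S : SkewShape r} : DecidableRel (ColAdj (S := S)) := fun a b =>
  inferInstanceAs (Decidable (a.1 = b.1 ∧ row b = row a + 1 ∧ col b = col a))

instance {S : SkewShape r} : DecidableRel (DiagAdj (S := S)) := fun a b =>
  inferInstanceAs (Decidable (a.1 = b.1 ∧ row b = row a + 1 ∧ col b = col a + 1))

/-- The set `R` of pairs `(a, b)` of boxes adjacent (west to east) in a row. -/
def rowPairs (S : SkewShape r) : Finset (S.Box × S.Box) :=
  Finset.univ.filter fun p => RowAdj p.1 p.2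

/-- The set `C` of pairs `(a, b)` of boxes adjacent (north to south) in a column. -/
def colPairs (S : SkewShape r) : Finset (S.Box × S.Box) :=
  Finset.univ.filter fun p => ColAdj p.1 p.2

/-- The set `D` of pairs `(a, b)` of boxes adjacent (northwest to southeast) in a diagonal. -/
def diagPairs (S : SkewShape r) : Finset (S.Box × S.Box) :=
  Finset.univ.filter fun p => DiagAdj p.1 p.2

/-- The graph on the boxes whose edges join the boxes that share a side. -/
def adjGraph (S : SkewShape r) : SimpleGraph S.Box :=
  SimpleGraph.fromRel fun a b => RowAdj a b ∨ ColAdj a b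

/-- The number `cc` of connected components of the shape. -/
noncomputable def cc (S : SkewShape r) : ℕ := Nat.card S.adjGraph.ConnectedComponent

/-- The sharp corners: boxes with no box above and no box to the left. -/
def sharpCorners (S : SkewShape r) : Finset S.Box :=
  Finset.univ.filter fun s => (¬ ∃ a, ColAdj a s) ∧ ¬ ∃ a, RowAdj a s

/-- The dull corners: boxes with a box to the left and a box above, but no box directly
northwest. -/
def dullCorners (S : SkewShape r) : Finset S.Box :=
  Finset.univ.filter fun d => (∃ a, RowAdj a d) ∧ (∃ a, ColAdj a d) ∧ ¬ ∃ a, DiagAdj a d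

/-- A placement of the numbers `1, …, n` in the boxes, one in each box, is standard if it
increases from left to right along rows and from top to bottom down columns.
`T i` is the box that contains the number `i + 1`, for `i = 0, …, n - 1`. -/
def IsStandard {S : SkewShape r} (T : Fin S.size ≃ S.Box) : Prop :=
  (∀ a b : S.Box, a.1 = b.1 → row a = row b → col a < col b → T.symm a < T.symm b) ∧
  (∀ a b : S.Box, a.1 = b.1 → col a = col b → row a < row b → T.symm a < T.symm b)

/-- The set of standard tableaux of a given shape. -/
abbrev StandardTableau (S : SkewShape r) : Type :=
  {T : Fin S.size ≃ S.Box // IsStandard T}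

noncomputable instance (S : SkewShape r) : Fintype S.StandardTableau := Fintype.ofFinite _

/-- `Δ⁽ᵏ⁾(T) = x_{T(1)} ^ k * ∏_{i=2}^{n} (q - q⁻¹) / (1 - x_{T(i-1)} x_{T(i)}⁻¹)`, for a standard
tableau `T` with `n ≥ 1` boxes, where `T(i)` is the box containing `i`. -/
def tableauDelta {K : Type*} [Field K] {S : SkewShape r} (hn : 0 < S.size) (x : S.Box → K) (q : K)
    (k : ℕ) (T : S.StandardTableau) : K :=
  x (T.1 ⟨0, hn⟩) ^ k *
    ∏ i : Fin (S.size - 1),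
      (q - q⁻¹) /
        (1 - x (T.1 ⟨i.1, by have := i.2; omega⟩) * (x (T.1 ⟨i.1 + 1, by have := i.2; omega⟩))⁻¹)

/-- The field `F(q, x_b : b ∈ S)` of rational functions over `F` in an indeterminate `q` (index
`none`) and indeterminates `x_b` (index `some b`). -/
abbrev RationalField (F : Type*) [Field F] (S : SkewShape r) : Type _ :=
  FractionRing (MvPolynomial (Option S.Box) F)

/-- The indeterminate `q`. -/
noncomputable def qVar (F : Type*) [Field F] (S : SkewShape r) : RationalField F S :=
  algebraMap (MvPolynomial (Option S.Box) F) (RationalField F S) (MvPolynomial.X none)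

/-- The indeterminate `x_b` attached to the box `b`. -/
noncomputable def boxVar (F : Type*) [Field F] (S : SkewShape r) (b : S.Box) : RationalField F S :=
  algebraMap (MvPolynomial (Option S.Box) F) (RationalField F S) (MvPolynomial.X (some b))

end SkewShape

/-- The elementary symmetric function `e_t` in the variables `x_a`, `a ∈ A`. -/
noncomputable def elemSymm {ι K : Type*} [DecidableEq ι] [CommRing K] (A : Finset ι) (x : ι → K)
    (t : ℕ) : K :=
  MvPolynomial.aeval (fun a : A => x a) (MvPolynomial.esymm A ℤ t)

/-- The complete homogeneous symmetric function `h_m` in the variables `x_a`, `a ∈ A`, for an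
integer `m`; it is `1` for `m = 0` and `0` for `m < 0`. -/
noncomputable def homogSymm {ι K : Type*} [DecidableEq ι] [CommRing K] (A : Finset ι) (x : ι → K)
    (m : ℤ) : K :=
  if 0 ≤ m then MvPolynomial.aeval (fun a : A => x a) (MvPolynomial.hsymm A ℤ m.toNat) else 0

section

open Finset

/-! Up to a constant, `Δ⁽ᵏ⁾(T)` is `x_{T(1)} ^ (k - 1)` times the product of the inverse differences
of consecutive values of `x` along `T`. Standard tableaux are linear extensions, so they can be
summed by removing the first box. The right generality is a set `A` of boxes closed towards the
southeast, together with a value `y` put in front of the chain (`chainSum`).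

By induction (`IsFilter.chainSum_eq`) this sum is a product over adjacent pairs in `A` times `∏ (x_d
- y) / ∏ (x_s - y)`, over the dull corners `d` and sharp corners `s` of `A`. The possible first
boxes are exactly the sharp corners, and there are more sharp than dull corners, so expanding this
quotient in partial fractions in `y` (`prod_sub_div_prod_sub_eq_sum`) gives one term for each first
box. The coefficient at `s` is the formula for `A.erase s` at `y = x s`
(`IsFilter.prod_boxWeight_erase`).

What remains is a sum over sharp corners of `x_s ^ (k - 1)` times such a coefficient. For `k = 0` it
is the partial fraction expansion at `y = 0`. For `k ≥ 1` it is a combination of power sums with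
Lagrange weights, which are complete homogeneous functions (`sum_pow_mul_nodalWeight`). The count
`|SC| = |DC| + cc` (`card_sharpCorners`) settles degrees, signs and powers of `q - q⁻¹`. -/

/-! ### Complete homogeneous symmetric functions -/

theorem aeval_hsymm_eq_sum {σ K : Type*} [Fintype σ] [DecidableEq σ] [CommRing K] (f : σ → K)
    (m : ℕ) :
    MvPolynomial.aeval f (MvPolynomial.hsymm σ ℤ m) = ∑ s : Sym σ m, (s.1.map f).prod := by
  simp [MvPolynomial.hsymm, ← Multiset.prod_hom']

theorem aeval_hsymm_option {σ K : Type*} [Fintype σ] [DecidableEq σ] [CommRing K]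
    (f : Option σ → K) (m : ℕ) :
    MvPolynomial.aeval f (MvPolynomial.hsymm (Option σ) ℤ (m + 1)) =
      MvPolynomial.aeval (fun a => f (some a)) (MvPolynomial.hsymm σ ℤ (m + 1)) +
        f none * MvPolynomial.aeval f (MvPolynomial.hsymm (Option σ) ℤ m) := by
  simp only [aeval_hsymm_eq_sum]
  rw [← Equiv.sum_comp (symOptionSuccEquiv (α := σ) (n := m)).symm, Fintype.sum_sum_type, add_comm,
    Finset.mul_sum]
  congr 1
  · refine Finset.sum_congr rfl fun s _ => ?_
    change Multiset.prod (Multiset.map f ((s.map Function.Embedding.some : Sym _ _) : Multiset _)) = _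
    simp [Sym.coe_map, Multiset.map_map]
  · refine Finset.sum_congr rfl fun s _ => ?_
    change Multiset.prod (Multiset.map f ((none ::ₛ s : Sym _ _) : Multiset _)) = _
    simp [Sym.coe_cons]

theorem aeval_hsymm_equiv {σ τ K : Type*} [Fintype σ] [DecidableEq σ] [Fintype τ] [DecidableEq τ]
    [CommRing K] (e : σ ≃ τ) (f : τ → K) (m : ℕ) :
    MvPolynomial.aeval (fun a => f (e a)) (MvPolynomial.hsymm σ ℤ m) =
      MvPolynomial.aeval f (MvPolynomial.hsymm τ ℤ m) := by
  rw [← MvPolynomial.rename_hsymm σ ℤ m e, MvPolynomial.aeval_rename]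
  rfl

theorem homogSymm_zero {ι K : Type*} [DecidableEq ι] [CommRing K] (A : Finset ι) (x : ι → K) :
    homogSymm A x 0 = 1 := by
  simp [homogSymm]

theorem homogSymm_of_neg {ι K : Type*} [DecidableEq ι] [CommRing K] (A : Finset ι) (x : ι → K)
    {m : ℤ} (hm : m < 0) : homogSymm A x m = 0 := by
  simp [homogSymm, not_le.mpr hm]

theorem homogSymm_empty {ι K : Type*} [DecidableEq ι] [CommRing K] (x : ι → K) (m : ℕ) :
    homogSymm ∅ x (m + 1) = 0 := by
  rw [homogSymm, if_pos (by positivity), aeval_hsymm_eq_sum]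
  have : ((m : ℤ) + 1).toNat = m + 1 := by omega
  rw [this]
  apply Finset.sum_eq_zero
  intro s _
  exfalso
  have h : Multiset.card s.1 = m + 1 := s.2
  have h0 : s.1 = 0 := Multiset.eq_zero_of_forall_notMem fun a => absurd a.2 (Finset.notMem_empty _)
  rw [h0] at h
  simp at h

/-- Monomials are split according to whether `x a` divides them. With integer degrees the recursion
also covers `m ≤ 0`. -/
theorem homogSymm_insert {ι K : Type*} [DecidableEq ι] [CommRing K] {A : Finset ι} {a : ι}
    (ha : a ∉ A) (x : ι → K) (m : ℤ) :
    homogSymm (insert a A) x m = homogSymm A x m + x a * homogSymm (insert a A) x (m - 1) := by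
  rcases lt_trichotomy m 0 with hm | rfl | hm
  · rw [homogSymm_of_neg _ _ hm, homogSymm_of_neg _ _ hm, homogSymm_of_neg _ _ (by omega)]
    ring
  · rw [homogSymm_zero, homogSymm_zero, homogSymm_of_neg _ _ (by omega)]
    ring
  · obtain ⟨n, rfl⟩ : ∃ n : ℕ, m = n + 1 := ⟨(m - 1).toNat, by omega⟩
    have h1 : ((n : ℤ) + 1).toNat = n + 1 := by omega
    have h2 : ((n : ℤ) + 1 - 1).toNat = n := by omega
    simp only [homogSymm]
    rw [if_pos (by omega), if_pos (by omega), if_pos (by omega), h1, h2]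
    have e := fun m => aeval_hsymm_equiv (Finset.subtypeInsertEquivOption ha).symm
      (fun b : {b // b ∈ insert a A} => x b) m
    rw [← e, ← e, aeval_hsymm_option]
    congr

/-! ### Lagrange weights and partial fractions -/

/-- Both sides obey the recursion of `homogSymm_insert`: subtracting `x a` times the sum for `j`
from the sum for `j + 1` produces factors `x s - x a`, which cancel the node `a` from each weight.
-/
theorem sum_pow_mul_nodalWeight {ι K : Type*} [DecidableEq ι] [Field K] (A : Finset ι) (x : ι → K)
    (hx : Set.InjOn x A) (j : ℕ) :
    ∑ s ∈ A, x s ^ j * Lagrange.nodalWeight A x s = homogSymm A x ((j : ℤ) + 1 - A.card) := by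
  induction A using Finset.induction_on generalizing j with
  | empty => simpa using (homogSymm_empty x j).symm
  | insert a A ha ih =>
    have hxA : Set.InjOn x A := hx.mono (by simp)
    induction j with
    | zero =>
      rcases A.eq_empty_or_nonempty with rfl | hA
      · simp [Lagrange.nodalWeight, homogSymm_zero]
      · have hc : 0 < A.card := hA.card_pos
        rw [homogSymm_of_neg _ _ (by rw [card_insert_of_notMem ha]; push_cast; omega)]
        -- The sum of the weights is the top coefficient of the interpolant of the constant `1`,
        -- which vanishes for at least two nodes.
        have := Lagrange.coeff_eq_sum hx (P := 1) (by
          rw [Polynomial.degree_one, card_insert_of_notMem ha]; exact_mod_cast Nat.succ_pos _)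
        rw [Polynomial.coeff_one, if_neg (by rw [card_insert_of_notMem ha]; omega)] at this
        rw [this]
        simp [Lagrange.nodalWeight, Finset.prod_inv_distrib]
    | succ j ihj =>
      rw [homogSymm_insert ha]
      have h1 : (((j + 1 : ℕ) : ℤ) + 1 - ((insert a A).card : ℕ)) = (j : ℤ) + 1 - A.card := by
        rw [card_insert_of_notMem ha]; push_cast; ring
      have h2 : (j : ℤ) + 1 - A.card - 1 = (j : ℤ) + 1 - ((insert a A).card : ℕ) := by
        rw [card_insert_of_notMem ha]; push_cast; ring
      rw [h1, h2, ← ih hxA j, ← ihj, Finset.mul_sum, ← sub_eq_iff_eq_add, ← Finset.sum_sub_distrib,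
        Finset.sum_insert ha]
      have h3 : x a ^ (j + 1) * Lagrange.nodalWeight (insert a A) x a -
          x a * (x a ^ j * Lagrange.nodalWeight (insert a A) x a) = 0 := by ring
      rw [h3, zero_add]
      refine Finset.sum_congr rfl fun s hs => ?_
      have hsa : s ≠ a := fun h => ha (h ▸ hs)
      have hne : x s - x a ≠ 0 := sub_ne_zero.mpr fun h =>
        hsa (hx (by simp [hs]) (by simp) h)
      have h4 : Lagrange.nodalWeight (insert a A) x s =
          (x s - x a)⁻¹ * Lagrange.nodalWeight A x s := by
        rw [Lagrange.nodalWeight, Finset.erase_insert_of_ne hsa.symm,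
          Finset.prod_insert (by simp [ha]), Lagrange.nodalWeight]
      rw [h4]
      field_simp
      ring

theorem prod_sub_div_prod_sub_eq_sum {ι K : Type*} [DecidableEq ι] [Field K] (D A : Finset ι)
    (x : ι → K) (hx : Set.InjOn x A) (hDA : D.card < A.card) (y : K) (hy : ∀ s ∈ A, x s ≠ y) :
    (∏ d ∈ D, (x d - y)) / ∏ s ∈ A, (x s - y) =
      ∑ s ∈ A, (x s - y)⁻¹ *
        ((∏ d ∈ D, (x d - x s)) / ∏ t ∈ A.erase s, (x t - x s)) := by
  -- Interpolating at the nodes `-x s` makes `P` evaluate at `-z` to `∏ (x d - z)`, with no signs to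
  -- track. As `deg P < |A|`, `P` is its own interpolant.
  have hv : Set.InjOn (fun s => -x s) A := fun s hs t ht h => hx hs ht (neg_injective h)
  set P : Polynomial K := ∏ d ∈ D, (Polynomial.X + Polynomial.C (x d)) with hP
  have hdeg : P.degree < A.card := by
    rw [hP, Polynomial.degree_prod]
    simpa using hDA
  have hyv : ∀ s ∈ A, -y ≠ -x s := fun s hs h => hy s hs (neg_injective h).symm
  have key := Lagrange.eval_interpolate_not_at_node (fun i => P.eval (-x i)) hyv
  rw [← Lagrange.eq_interpolate hv hdeg, Lagrange.eval_nodal] at key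
  have e : ∀ z, P.eval (-z) = ∏ d ∈ D, (x d - z) := by
    intro z
    rw [hP, Polynomial.eval_prod]
    exact Finset.prod_congr rfl fun d _ => by simp; ring
  have e2 : ∏ s ∈ A, (-y - -x s) = ∏ s ∈ A, (x s - y) :=
    Finset.prod_congr rfl fun d _ => by ring
  have hne : ∏ s ∈ A, (x s - y) ≠ 0 :=
    Finset.prod_ne_zero_iff.mpr fun s hs => sub_ne_zero.mpr (hy s hs)
  rw [e, e2] at key
  rw [key, mul_div_cancel_left₀ _ hne]
  refine Finset.sum_congr rfl fun s _ => ?_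
  rw [e, Lagrange.nodalWeight, Finset.prod_inv_distrib]
  have e3 : ∏ j ∈ A.erase s, (-x s - -x j) = ∏ t ∈ A.erase s, (x t - x s) :=
    Finset.prod_congr rfl fun d _ => by ring
  rw [e3, show -y - -x s = x s - y by ring]
  ring

theorem prod_sub_eq_sum_elemSymm {ι K : Type*} [DecidableEq ι] [Field K] (D : Finset ι)
    (x : ι → K) (z : K) :
    ∏ d ∈ D, (z - x d) =
      ∑ t ∈ range (D.card + 1), (-1) ^ t * elemSymm D x t * z ^ (D.card - t) := by
  have h := congrArg (Polynomial.eval z) (Multiset.prod_X_sub_X_eq_sum_esymm (D.val.map x))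
  rw [Multiset.map_map, Polynomial.eval_multiset_prod, Multiset.map_map] at h
  simp only [Function.comp_def, Polynomial.eval_sub, Polynomial.eval_X, Polynomial.eval_C,
    Polynomial.eval_finsetSum, Polynomial.eval_mul, Polynomial.eval_pow, Polynomial.eval_neg,
    Polynomial.eval_one, Multiset.card_map, Finset.card_val] at h
  refine Eq.trans h (Finset.sum_congr rfl fun t _ => ?_)
  rw [elemSymm, MvPolynomial.aeval_esymm_eq_multiset_esymm, ← mul_assoc]
  congr 3
  rw [Finset.univ_eq_attach, Finset.attach_val]
  exact (Multiset.attach_map_val' D.val x).symm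

/-- Reversing all differences leaves `|A| - 1 - |D| = c - 1` signs; the numerator is then expanded
by Vieta and each power of `x s` is summed against the Lagrange weights. -/
theorem sum_pow_mul_prod_sub_div_prod_sub {ι K : Type*} [DecidableEq ι] [Field K]
    (D A : Finset ι) (x : ι → K) (hx : Set.InjOn x A) (c : ℕ) (hc : 0 < c)
    (hDA : A.card = D.card + c) (j : ℕ) :
    ∑ s ∈ A, x s ^ j * ((∏ d ∈ D, (x d - x s)) / ∏ t ∈ A.erase s, (x t - x s)) =
      (-1) ^ (c - 1) * ∑ t ∈ range (D.card + 1), (-1) ^ t * elemSymm D x t *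
        homogSymm A x ((j : ℤ) + 1 - t - c) := by
  have step : ∀ s ∈ A, x s ^ j * ((∏ d ∈ D, (x d - x s)) / ∏ t ∈ A.erase s, (x t - x s)) =
      (-1) ^ (c - 1) * ∑ t ∈ range (D.card + 1), (-1) ^ t * elemSymm D x t *
        (x s ^ (j + (D.card - t)) * Lagrange.nodalWeight A x s) := by
    intro s hs
    have hsign : ∀ B : Finset ι, ∏ d ∈ B, (x d - x s) = (-1) ^ B.card * ∏ d ∈ B, (x s - x d) := by
      intro B
      rw [← Finset.prod_const, ← Finset.prod_mul_distrib]
      exact Finset.prod_congr rfl fun d _ => by ring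
    rw [hsign, hsign, prod_sub_eq_sum_elemSymm, Finset.card_erase_of_mem hs, Lagrange.nodalWeight,
      Finset.prod_inv_distrib, hDA, show D.card + c - 1 = D.card + (c - 1) by omega, pow_add,
      Finset.mul_sum, Finset.mul_sum, Finset.sum_div, Finset.mul_sum]
    refine Finset.sum_congr rfl fun t _ => ?_
    have h1 : ((-1 : K) ^ D.card) ≠ 0 := pow_ne_zero _ (by simp)
    have h2 : ((-1 : K) ^ (c - 1)) * (-1) ^ (c - 1) = 1 := by
      rw [← mul_pow]; simp
    have h3 : ((-1 : K) ^ (c - 1))⁻¹ = (-1) ^ (c - 1) := inv_eq_of_mul_eq_one_left h2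
    rw [mul_assoc ((-1 : K) ^ D.card), mul_div_mul_left _ _ h1, div_eq_mul_inv, mul_inv, h3]
    ring
  rw [Finset.sum_congr rfl step, ← Finset.mul_sum, Finset.sum_comm]
  congr 1
  refine Finset.sum_congr rfl fun t ht => ?_
  rw [← Finset.mul_sum, sum_pow_mul_nodalWeight A x hx]
  congr 2
  have : t ≤ D.card := Nat.lt_succ_iff.mp (Finset.mem_range.mp ht)
  rw [hDA]
  push_cast [this]
  ring

/-! ### Linear extensions and the recursion on the first element -/

/-- `f` enumerates the finite set `A`, without repetitions, in an order compatible with `rel`. -/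
def IsLinearExtension {α : Type*} [DecidableEq α] (rel : α → α → Prop) (A : Finset α) {n : ℕ}
    (f : Fin n → α) : Prop :=
  Function.Injective f ∧ (∀ a, a ∈ A ↔ ∃ i, f i = a) ∧ ∀ i j, rel (f i) (f j) → i < j

theorem isLinearExtension_cons {α : Type*} [DecidableEq α] {rel : α → α → Prop}
    (hrel : ∀ a, ¬ rel a a) (A : Finset α) {n : ℕ} (a : α) (g : Fin n → α) :
    IsLinearExtension rel A (Fin.cons a g : Fin (n + 1) → α) ↔
      (a ∈ A ∧ ∀ b ∈ A, ¬ rel b a) ∧ IsLinearExtension rel (A.erase a) g := by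
  constructor
  · rintro ⟨hinj, hmem, hlt⟩
    rw [Fin.cons_injective_iff] at hinj
    refine ⟨⟨(hmem a).2 ⟨0, rfl⟩, fun b hb h => ?_⟩, hinj.2, fun b => ?_, fun i j h => ?_⟩
    · obtain ⟨i, rfl⟩ := (hmem b).1 hb
      exact absurd (hlt i 0 h) (by simp)
    · rw [mem_erase, hmem]
      constructor
      · rintro ⟨hne, i, hi⟩
        refine Fin.cases (fun h => absurd h.symm hne) (fun i h => ⟨i, h⟩) i hi
      · rintro ⟨i, rfl⟩
        exact ⟨fun h => hinj.1 ⟨i, h⟩, i.succ, rfl⟩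
    · exact Fin.succ_lt_succ_iff.mp (hlt i.succ j.succ h)
  · rintro ⟨⟨ha, hmin⟩, hinj, hmem, hlt⟩
    refine ⟨Fin.cons_injective_iff.mpr ⟨?_, hinj⟩, fun b => ?_, fun i j => ?_⟩
    · rintro ⟨i, hi⟩
      exact (mem_erase.mp ((hmem a).2 ⟨i, hi⟩)).1 rfl
    · constructor
      · intro hb
        by_cases h : b = a
        · exact ⟨0, h.symm⟩
        · obtain ⟨i, hi⟩ := (hmem b).1 (mem_erase.mpr ⟨h, hb⟩)
          exact ⟨i.succ, hi⟩
      · rintro ⟨i, rfl⟩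
        refine Fin.cases ha (fun i => ?_) i
        exact (mem_erase.mp ((hmem (g i)).2 ⟨i, rfl⟩)).2
    · refine Fin.cases ?_ (fun j => ?_) j
      · refine Fin.cases (fun h => absurd h (hrel a)) (fun i h => ?_) i
        exact absurd h (hmin _ (mem_erase.mp ((hmem (g i)).2 ⟨i, rfl⟩)).2)
      · refine Fin.cases (fun _ => Fin.succ_pos j) (fun i h => ?_) i
        exact Fin.succ_lt_succ_iff.mpr (hlt i j h)

/-- The sum over the linear extensions `a₁, …, aₙ` of `A` of
`∏ 1 / (x aᵢ - x aᵢ₋₁)`, where `x a₀` is read as `y`. -/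
noncomputable def chainSum {α K : Type*} [Fintype α] [DecidableEq α] [Field K]
    (rel : α → α → Prop) (x : α → K) (n : ℕ) (A : Finset α) (y : K) : K :=
  open Classical in
  ∑ f : Fin n → α, if IsLinearExtension rel A f then
    ∏ i : Fin n, ((Fin.cons y (x ∘ f) : Fin (n + 1) → K) i.succ -
      (Fin.cons y (x ∘ f) : Fin (n + 1) → K) i.castSucc)⁻¹ else 0

/-- The weight `φ` of the first element is left free: `(x s - y)⁻¹` gives the recursion for
`chainSum`, and `x s ^ k * (x s)⁻¹` gives the sum over tableaux. -/
theorem sum_linearExtension_succ {α K : Type*} [Fintype α] [DecidableEq α] [Field K]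
    {rel : α → α → Prop} (hrel : ∀ a, ¬ rel a a) (x φ : α → K) (n : ℕ) (A : Finset α) :
    (open Classical in
    ∑ f : Fin (n + 1) → α, if IsLinearExtension rel A f then
      φ (f 0) * ∏ i : Fin n, (x (f i.succ) - x (f i.castSucc))⁻¹ else 0) =
    open Classical in
    ∑ s ∈ A with ∀ b ∈ A, ¬ rel b s, φ s * chainSum rel x n (A.erase s) (x s) := by
  classical
  have hA : ∀ g : α → K, ∑ a ∈ A, g a = ∑ a, if a ∈ A then g a else 0 := fun g => by simp
  rw [← Equiv.sum_comp (Fin.consEquiv fun _ => α), Fintype.sum_prod_type, Finset.sum_filter,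
    hA]
  refine Finset.sum_congr rfl fun a _ => ?_
  rw [← ite_and, chainSum, Finset.mul_sum]
  split_ifs with h
  · refine Finset.sum_congr rfl fun g _ => ?_
    have e : (Fin.consEquiv fun _ => α) (a, g) = (Fin.cons a g : Fin (n + 1) → α) := rfl
    rw [e, isLinearExtension_cons hrel, mul_ite, mul_zero]
    simp only [h, true_and]
    have e2 : (Fin.cons (x a) (x ∘ g) : Fin (n + 1) → K) = x ∘ (Fin.cons a g : Fin (n + 1) → α) := by
      funext i
      refine Fin.cases rfl (fun i => rfl) i
    rw [e2]
    congr 1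
    exact propext ⟨And.right, fun hh => ⟨h.2, hh⟩⟩
  · refine Finset.sum_eq_zero fun g _ => if_neg fun hh => h ?_
    exact ((isLinearExtension_cons hrel A a g).1 hh).1

theorem chainSum_succ {α K : Type*} [Fintype α] [DecidableEq α] [Field K]
    {rel : α → α → Prop} (hrel : ∀ a, ¬ rel a a) (x : α → K) (n : ℕ) (A : Finset α) (y : K) :
    chainSum rel x (n + 1) A y =
    open Classical in
    ∑ s ∈ A with ∀ b ∈ A, ¬ rel b s, (x s - y)⁻¹ * chainSum rel x n (A.erase s) (x s) := by
  classical
  rw [← sum_linearExtension_succ hrel x (fun s => (x s - y)⁻¹), chainSum]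
  refine Finset.sum_congr rfl fun f _ => ?_
  rw [Fin.prod_univ_succ]
  rfl

theorem chainSum_zero {α K : Type*} [Fintype α] [DecidableEq α] [Field K]
    (rel : α → α → Prop) (x : α → K) (y : K) : chainSum rel x 0 ∅ y = 1 := by
  rw [chainSum, Fintype.sum_unique, if_pos]
  · simp
  · exact ⟨fun i => i.elim0, fun a => by simp, fun i => i.elim0⟩

namespace SkewShape

variable {r : ℕ} {S : SkewShape r}

/-! ### Southeast-closed sets of boxes and their corners -/

theorem box_ext {a b : S.Box} (h : a.1 = b.1) (hr : row a = row b) (hc : col a = col b) :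
    a = b := by
  obtain ⟨i, ⟨⟨p, c⟩, ha⟩⟩ := a
  obtain ⟨j, ⟨⟨p', c'⟩, hb⟩⟩ := b
  simp only [row, col] at h hr hc
  subst h hr hc
  rfl

theorem exists_box {a b : S.Box} (h : a.1 = b.1) {p c : ℕ} (hp : row a ≤ p) (hp' : p ≤ row b)
    (hc : col a ≤ c) (hc' : c ≤ col b) : ∃ e : S.Box, e.1 = a.1 ∧ row e = p ∧ col e = c := by
  obtain ⟨i, ⟨⟨p₁, c₁⟩, ha⟩⟩ := a
  obtain ⟨j, ⟨⟨p₂, c₂⟩, hb⟩⟩ := b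
  simp only [row, col] at h hp hp' hc hc'
  subst h
  refine ⟨⟨i, ⟨(p, c), ?_⟩⟩, rfl, rfl, rfl⟩
  rw [Finset.mem_sdiff] at ha hb ⊢
  exact ⟨(S.outer i).isLowerSet (show (p, c) ≤ (p₂, c₂) from ⟨hp', hc'⟩) hb.1,
    fun hh => ha.2 ((S.inner i).isLowerSet (show (p₁, c₁) ≤ (p, c) from ⟨hp, hc⟩) hh)⟩

/-- `a` precedes `b` in a row or in a column of the shape. -/
def Precedes (a b : S.Box) : Prop :=
  a.1 = b.1 ∧ (row a = row b ∧ col a < col b ∨ col a = col b ∧ row a < row b)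

/-- A set of boxes closed under going weakly southeast in the same diagram. -/
def IsFilter (A : Finset S.Box) : Prop :=
  ∀ a ∈ A, ∀ b : S.Box, a.1 = b.1 → row a ≤ row b → col a ≤ col b → b ∈ A

/-- The boxes of `A` with no box of `A` above and none to the left. -/
def sharpIn (A : Finset S.Box) : Finset S.Box :=
  A.filter fun s => (¬ ∃ a ∈ A, ColAdj a s) ∧ ¬ ∃ a ∈ A, RowAdj a s

/-- The boxes of `A` with a box of `A` above and one to the left, but none northwest. -/
def dullIn (A : Finset S.Box) : Finset S.Box :=
  A.filter fun d => (∃ a ∈ A, RowAdj a d) ∧ (∃ a ∈ A, ColAdj a d) ∧ ¬ ∃ a ∈ A, DiagAdj a d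

theorem sharpIn_univ : sharpIn (univ : Finset S.Box) = S.sharpCorners := by
  ext s
  simp [sharpIn, sharpCorners]

theorem dullIn_univ : dullIn (univ : Finset S.Box) = S.dullCorners := by
  ext d
  simp [dullIn, dullCorners]

theorem isFilter_univ : IsFilter (univ : Finset S.Box) := fun _ _ _ _ _ _ => mem_univ _

theorem not_precedes_self (a : S.Box) : ¬ Precedes a a := by
  rintro ⟨-, h | h⟩ <;> omega

/-- A filter contains all boxes between two of its boxes. -/
theorem IsFilter.exists_mem {A : Finset S.Box} (hA : IsFilter A) {a b : S.Box} (ha : a ∈ A)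
    (h : a.1 = b.1) {p c : ℕ} (hp : row a ≤ p) (hp' : p ≤ row b)
    (hc : col a ≤ c) (hc' : c ≤ col b) : ∃ e ∈ A, e.1 = a.1 ∧ row e = p ∧ col e = c := by
  obtain ⟨e, he, rfl, rfl⟩ := exists_box h hp hp' hc hc'
  exact ⟨e, hA a ha e he.symm hp hc, he, rfl, rfl⟩

/-- If `a` were strictly higher or strictly further left, convexity would put the box just above
`s`, or just left of it, in `A`. -/
theorem IsFilter.eq_of_le_sharp {A : Finset S.Box} (hA : IsFilter A) {s a : S.Box}
    (hs : s ∈ sharpIn A) (ha : a ∈ A) (h : a.1 = s.1) (hr : row a ≤ row s)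
    (hc : col a ≤ col s) : a = s := by
  obtain ⟨hsA, hcol, hrow⟩ := mem_filter.mp hs
  have h1 : ¬ row a < row s := fun hlt => by
    obtain ⟨e, he, h1, h2, h3⟩ := hA.exists_mem ha h (p := row s - 1) (c := col s)
      (by omega) (by omega) hc le_rfl
    exact hcol ⟨e, he, h1.trans h, by omega, h3.symm⟩
  have h2 : ¬ col a < col s := fun hlt => by
    obtain ⟨e, he, h1, h2, h3⟩ := hA.exists_mem ha h (p := row s) (c := col s - 1)
      hr le_rfl (by omega) (by omega)
    exact hrow ⟨e, he, h1.trans h, h2.symm, by omega⟩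
  exact box_ext h (by omega) (by omega)

theorem IsFilter.filter_minimal {A : Finset S.Box} (hA : IsFilter A)
    [DecidablePred fun s : S.Box => ∀ b ∈ A, ¬ Precedes b s] :
    A.filter (fun s => ∀ b ∈ A, ¬ Precedes b s) = sharpIn A := by
  ext s
  constructor
  · intro hs
    obtain ⟨hsA, hs⟩ := mem_filter.mp hs
    refine mem_filter.mpr ⟨hsA, ?_, ?_⟩
    · rintro ⟨a, ha, h1, h2, h3⟩
      exact hs a ha ⟨h1, Or.inr ⟨h3.symm, by omega⟩⟩
    · rintro ⟨a, ha, h1, h2, h3⟩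
      exact hs a ha ⟨h1, Or.inl ⟨h2.symm, by omega⟩⟩
  · intro hs
    refine mem_filter.mpr ⟨(mem_filter.mp hs).1, fun b hb h => ?_⟩
    have : b = s := hA.eq_of_le_sharp hs hb h.1 (by rcases h.2 with h | h <;> omega)
      (by rcases h.2 with h | h <;> omega)
    exact not_precedes_self s (this ▸ h)

theorem IsFilter.erase {A : Finset S.Box} (hA : IsFilter A) {s : S.Box} (hs : s ∈ sharpIn A) :
    IsFilter (A.erase s) := by
  intro a ha b h hr hc
  obtain ⟨hne, haA⟩ := mem_erase.mp ha
  refine mem_erase.mpr ⟨?_, hA a haA b h hr hc⟩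
  rintro rfl
  exact hne (hA.eq_of_le_sharp hs haA h hr hc)

theorem IsFilter.exists_colAdj_of_diagAdj {A : Finset S.Box} (hA : IsFilter A) {a b : S.Box}
    (ha : a ∈ A) (h : DiagAdj a b) : ∃ e ∈ A, ColAdj e b := by
  obtain ⟨h1, h2, h3⟩ := h
  obtain ⟨e, he, h4, h5, h6⟩ := hA.exists_mem ha h1 (p := row a) (c := col b)
    le_rfl (by omega) (by omega) le_rfl
  exact ⟨e, he, h4.trans h1, by omega, h6.symm⟩

theorem IsFilter.exists_rowAdj_of_diagAdj {A : Finset S.Box} (hA : IsFilter A) {a b : S.Box}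
    (ha : a ∈ A) (h : DiagAdj a b) : ∃ e ∈ A, RowAdj e b := by
  obtain ⟨h1, h2, h3⟩ := h
  obtain ⟨e, he, h4, h5, h6⟩ := hA.exists_mem ha h1 (p := row b) (c := col a)
    (by omega) le_rfl le_rfl (by omega)
  exact ⟨e, he, h4.trans h1, h5.symm, by omega⟩

/-! ### Counting sharp and dull corners row by row -/

/-- The row of a box, together with the index of its diagram. -/
def rowIndex (b : S.Box) : Fin r × ℕ := (b.1, row b)

theorem rowIndex_eq_iff {a b : S.Box} : rowIndex a = rowIndex b ↔ a.1 = b.1 ∧ row a = row b :=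
  Prod.ext_iff

open Classical in
/-- The nonempty rows of `A` that are not joined to the row above. -/
noncomputable def rootRows (A : Finset S.Box) : Finset (Fin r × ℕ) :=
  (A.filter fun a => ∀ b ∈ A, rowIndex b = rowIndex a → ∀ c ∈ A, ¬ ColAdj c b).image rowIndex

theorem exists_leftmost {A : Finset S.Box} {a : S.Box} (ha : a ∈ A) :
    ∃ s ∈ A, rowIndex s = rowIndex a ∧ ∀ b ∈ A, rowIndex b = rowIndex a → col s ≤ col b := by
  classical
  obtain ⟨s, hs, hmin⟩ := Finset.exists_min_image (A.filter fun b => rowIndex b = rowIndex a) col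
    ⟨a, mem_filter.mpr ⟨ha, rfl⟩⟩
  obtain ⟨hs, h⟩ := mem_filter.mp hs
  exact ⟨s, hs, h, fun b hb hb' => hmin b (mem_filter.mpr ⟨hb, hb'⟩)⟩

theorem IsFilter.injOn_rowIndex_sharp {A : Finset S.Box} (hA : IsFilter A) :
    Set.InjOn rowIndex (sharpIn A : Set S.Box) := by
  intro s hs t ht h
  obtain ⟨h1, h2⟩ := rowIndex_eq_iff.mp h
  rcases le_total (col s) (col t) with hc | hc
  · exact hA.eq_of_le_sharp ht (mem_filter.mp hs).1 h1 h2.le hc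
  · exact (hA.eq_of_le_sharp hs (mem_filter.mp ht).1 h1.symm h2.ge hc).symm

/-- To the left of a dull corner no box of its row has a box above it. -/
theorem IsFilter.not_colAdj_left_of_dull {A : Finset S.Box} (hA : IsFilter A) {b d n : S.Box}
    (hd : d ∈ dullIn A) (h : rowIndex b = rowIndex d) (hc : col b < col d) (hn : n ∈ A)
    (hnb : ColAdj n b) : False := by
  obtain ⟨hdA, -, ⟨m, hm, hm1, hm2, hm3⟩, hdiag⟩ := mem_filter.mp hd
  obtain ⟨h1, h2⟩ := rowIndex_eq_iff.mp h
  obtain ⟨hn1, hn2, hn3⟩ := hnb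
  obtain ⟨e, he, h4, h5, h6⟩ := hA.exists_mem hn (b := m) (hn1.trans (h1.trans hm1.symm))
    (p := row n) (c := col d - 1) le_rfl (by omega) (by omega) (by omega)
  exact hdiag ⟨e, he, h4.trans (hn1.trans h1), by omega, by omega⟩

theorem IsFilter.injOn_rowIndex_dull {A : Finset S.Box} (hA : IsFilter A) :
    Set.InjOn rowIndex (dullIn A : Set S.Box) := by
  intro s hs t ht h
  obtain ⟨h1, h2⟩ := rowIndex_eq_iff.mp h
  obtain ⟨-, -, ⟨m, hm, hms⟩, -⟩ := mem_filter.mp hs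
  obtain ⟨-, -, ⟨m', hm', hmt⟩, -⟩ := mem_filter.mp ht
  rcases lt_trichotomy (col s) (col t) with hc | hc | hc
  · exact (hA.not_colAdj_left_of_dull ht h hc hm hms).elim
  · exact box_ext h1 h2 hc
  · exact (hA.not_colAdj_left_of_dull hs h.symm hc hm' hmt).elim

theorem not_rowAdj_of_leftmost {A : Finset S.Box} {s : S.Box}
    (hs : ∀ b ∈ A, rowIndex b = rowIndex s → col s ≤ col b) : ¬ ∃ a ∈ A, RowAdj a s := by
  rintro ⟨a, ha, h1, h2, h3⟩
  have := hs a ha (rowIndex_eq_iff.mpr ⟨h1, h2.symm⟩)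
  omega

/-- The leftmost box of a row with a dull corner is sharp: it lies strictly left of the dull corner,
hence has nothing above it. -/
theorem IsFilter.image_dull_subset {A : Finset S.Box} (hA : IsFilter A) :
    (dullIn A).image rowIndex ⊆ (sharpIn A).image rowIndex := by
  intro ρ hρ
  obtain ⟨d, hd, rfl⟩ := mem_image.mp hρ
  have hdA := (mem_filter.mp hd).1
  obtain ⟨s, hs, h, hmin⟩ := exists_leftmost hdA
  refine mem_image.mpr ⟨s, mem_filter.mpr ⟨hs, ?_, ?_⟩, h⟩
  · rintro ⟨n, hn, hns⟩
    rcases (hmin d hdA rfl).lt_or_eq with hc | hc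
    · exact hA.not_colAdj_left_of_dull hd h hc hn hns
    · obtain ⟨h1, h2⟩ := rowIndex_eq_iff.mp h
      have hsd : s = d := box_ext h1 h2 hc
      exact not_rowAdj_of_leftmost (hsd ▸ hmin) (mem_filter.mp hd).2.1
  · exact not_rowAdj_of_leftmost (h ▸ hmin)

/-- If a row with a sharp corner has a box with a neighbour above, the leftmost such box is dull: it
lies to the right of the sharp corner, so it has a left neighbour, and a northwest box would sit
above that neighbour. -/
theorem IsFilter.image_sharp_sdiff {A : Finset S.Box} (hA : IsFilter A) :
    (sharpIn A).image rowIndex \ (dullIn A).image rowIndex = rootRows A := by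
  classical
  ext ρ
  rw [mem_sdiff, rootRows]
  constructor
  · rintro ⟨hρ, hρ'⟩
    obtain ⟨s, hs, rfl⟩ := mem_image.mp hρ
    have hsA := (mem_filter.mp hs).1
    refine mem_image.mpr ⟨s, mem_filter.mpr ⟨hsA, fun b hb hbs c hc hcb => hρ' ?_⟩, rfl⟩
    obtain ⟨d, hd, hmin⟩ := Finset.exists_min_image
      (A.filter fun b => rowIndex b = rowIndex s ∧ ∃ c ∈ A, ColAdj c b) col
      ⟨b, mem_filter.mpr ⟨hb, hbs, c, hc, hcb⟩⟩
    obtain ⟨hdA, hds, n, hn, hnd⟩ := mem_filter.mp hd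
    refine mem_image.mpr ⟨d, mem_filter.mpr ⟨hdA, ?_, ⟨n, hn, hnd⟩, ?_⟩, hds⟩
    · obtain ⟨h1, h2⟩ := rowIndex_eq_iff.mp hds
      have hlt : col s < col d := by
        by_contra hle
        have := hA.eq_of_le_sharp hs hdA h1 h2.le (by omega)
        subst this
        exact (mem_filter.mp hs).2.1 ⟨n, hn, hnd⟩
      obtain ⟨w, hw, h3, h4, h5⟩ := hA.exists_mem hsA h1.symm (p := row d) (c := col d - 1)
        h2.ge le_rfl (by omega) (by omega)
      exact ⟨w, hw, h3.trans h1.symm, h4.symm, by omega⟩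
    · rintro ⟨e, he, hed⟩
      obtain ⟨w, hw, hwd⟩ := hA.exists_rowAdj_of_diagAdj he hed
      have := hmin w (mem_filter.mpr ⟨hw, (rowIndex_eq_iff.mpr ⟨hwd.1, hwd.2.1.symm⟩).trans hds,
        e, he, hed.1.trans hwd.1.symm, ?_, ?_⟩)
      · have := hwd.2.2; omega
      · have := hwd.2.1; have := hed.2.1; omega
      · have := hwd.2.2; have := hed.2.2; omega
  · intro hρ
    obtain ⟨a, ha, rfl⟩ := mem_image.mp hρ
    obtain ⟨haA, hroot⟩ := mem_filter.mp ha
    constructor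
    · obtain ⟨s, hs, h, hmin⟩ := exists_leftmost haA
      refine mem_image.mpr ⟨s, mem_filter.mpr ⟨hs, ?_, not_rowAdj_of_leftmost (h ▸ hmin)⟩, h⟩
      rintro ⟨c, hc, hcs⟩
      exact hroot s hs h c hc hcs
    · intro hmem
      obtain ⟨d, hd, hda⟩ := mem_image.mp hmem
      obtain ⟨hdA, -, ⟨n, hn, hnd⟩, -⟩ := mem_filter.mp hd
      exact hroot d hdA hda n hn hnd

/-- Each row has at most one sharp and at most one dull corner, so corners can be counted through
their rows. -/
theorem IsFilter.card_sharpIn {A : Finset S.Box} (hA : IsFilter A) :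
    (sharpIn A).card = (dullIn A).card + (rootRows A).card := by
  rw [← hA.image_sharp_sdiff, card_sdiff_of_subset hA.image_dull_subset,
    ← card_image_of_injOn hA.injOn_rowIndex_sharp, ← card_image_of_injOn hA.injOn_rowIndex_dull]
  have := card_le_card hA.image_dull_subset
  omega

theorem rootRows_nonempty {A : Finset S.Box} (hA : A.Nonempty) : (rootRows A).Nonempty := by
  classical
  obtain ⟨a, ha, hmin⟩ := Finset.exists_min_image A row hA
  refine ⟨rowIndex a, mem_image.mpr ⟨a, mem_filter.mpr ⟨ha, fun b _ hba c hc hcb => ?_⟩, rfl⟩⟩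
  have h1 := (rowIndex_eq_iff.mp hba).2
  have h2 := hcb.2.1
  have h3 := hmin c hc
  omega

/-! ### Root rows and connected components -/

open Classical in
/-- The first row of the component of the boxes in row `p` of the `i`-th diagram. -/
noncomputable def rootRow (S : SkewShape r) (i : Fin r) : ℕ → ℕ
  | 0 => 0
  | p + 1 => if ∃ c d : S.Box, ColAdj c d ∧ d.1 = i ∧ row d = p + 1 then rootRow S i p else p + 1

theorem rootRow_of_colAdj {a b : S.Box} (h : ColAdj a b) :
    rootRow S b.1 (row b) = rootRow S a.1 (row a) := by
  have h2 := h.2.1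
  rw [h2, rootRow, if_pos ⟨a, b, h, rfl, h2⟩, h.1]

theorem reachable_of_rowAdj {a b : S.Box} (h : RowAdj a b) : S.adjGraph.Reachable a b := by
  refine SimpleGraph.Adj.reachable ((SimpleGraph.fromRel_adj _ _ _).mpr ⟨?_, Or.inl (Or.inl h)⟩)
  rintro rfl
  have := h.2.2
  omega

theorem reachable_of_colAdj {a b : S.Box} (h : ColAdj a b) : S.adjGraph.Reachable a b := by
  refine SimpleGraph.Adj.reachable ((SimpleGraph.fromRel_adj _ _ _).mpr ⟨?_, Or.inl (Or.inr h)⟩)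
  rintro rfl
  have := h.2.1
  omega

theorem reachable_of_row_eq {a b : S.Box} (h : a.1 = b.1) (hr : row a = row b) :
    S.adjGraph.Reachable a b := by
  suffices H : ∀ (n : ℕ) (a b : S.Box), a.1 = b.1 → row a = row b → col b = col a + n →
      S.adjGraph.Reachable a b by
    rcases le_total (col a) (col b) with hc | hc
    · exact H (col b - col a) a b h hr (by omega)
    · exact (H (col a - col b) b a h.symm hr.symm (by omega)).symm
  intro n
  induction n with
  | zero =>
    intro a b h hr hc
    rw [box_ext h hr hc.symm]
  | succ n ih =>
    intro a b h hr hc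
    obtain ⟨e, h1, h2, h3⟩ := exists_box h (p := row a) (c := col a + n) le_rfl hr.le
      (by omega) (by omega)
    exact (ih a e h1.symm h2.symm h3).trans
      (reachable_of_rowAdj ⟨h1.trans h, by omega, by omega⟩)

theorem exists_reachable_rootRow (b : S.Box) : ∃ e : S.Box, S.adjGraph.Reachable b e ∧
    rowIndex e = (b.1, rootRow S b.1 (row b)) ∧ rowIndex e ∈ rootRows (univ : Finset S.Box) := by
  classical
  induction hp : row b generalizing b with
  | zero =>
    refine ⟨b, SimpleGraph.Reachable.refl b, Prod.ext rfl hp,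
      mem_image.mpr ⟨b, mem_filter.mpr ⟨mem_univ _, fun d _ hd c _ hcd => ?_⟩, rfl⟩⟩
    have h1 := (rowIndex_eq_iff.mp hd).2
    have h2 := hcd.2.1
    omega
  | succ p ih =>
    by_cases h : ∃ c d : S.Box, ColAdj c d ∧ d.1 = b.1 ∧ row d = p + 1
    · obtain ⟨c, d, hcd, hd1, hd2⟩ := h
      obtain ⟨e, he1, he2, he3⟩ := ih c (by have := hcd.2.1; omega)
      refine ⟨e, ((reachable_of_row_eq hd1.symm (hp.trans hd2.symm)).trans
        (reachable_of_colAdj hcd).symm).trans he1, ?_, he3⟩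
      rw [he2, rootRow, if_pos ⟨c, d, hcd, hd1, hd2⟩, hcd.1, hd1]
    · refine ⟨b, SimpleGraph.Reachable.refl b, ?_,
        mem_image.mpr ⟨b, mem_filter.mpr ⟨mem_univ _, fun d _ hd c _ hcd => h ?_⟩, rfl⟩⟩
      · rw [rootRow, if_neg h, rowIndex, hp]
      · obtain ⟨h1, h2⟩ := rowIndex_eq_iff.mp hd
        exact ⟨c, d, hcd, h1, h2.trans hp⟩

/-- Climbing from a box to its root row is constant along edges, so it defines a map on components.
It is injective because every box is joined to its root row and each row of a skew shape is
contiguous. -/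
theorem card_rootRows_univ : (rootRows (univ : Finset S.Box)).card = S.cc := by
  classical
  have hadj : ∀ a b : S.Box, RowAdj a b ∨ ColAdj a b →
      (a.1, rootRow S a.1 (row a)) = (b.1, rootRow S b.1 (row b)) := by
    rintro a b (h | h)
    · rw [h.1, h.2.1]
    · rw [rootRow_of_colAdj h, h.1]
  have hreach : ∀ a b : S.Box, S.adjGraph.Reachable a b →
      (a.1, rootRow S a.1 (row a)) = (b.1, rootRow S b.1 (row b)) := by
    rintro a b ⟨w⟩
    induction w with
    | nil => rfl
    | cons h _ ih =>
      refine Eq.trans ?_ ih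
      rcases ((SimpleGraph.fromRel_adj _ _ _).mp h).2 with h | h
      · exact hadj _ _ h
      · exact (hadj _ _ h).symm
  let f : S.adjGraph.ConnectedComponent → Fin r × ℕ :=
    Quot.lift (fun b => (b.1, rootRow S b.1 (row b))) hreach
  have hf : Function.Injective f := by
    intro u v
    refine Quot.induction_on₂ u v fun a b hab => Quot.sound ?_
    obtain ⟨e, he, he', -⟩ := exists_reachable_rootRow a
    obtain ⟨e', hb, hb', -⟩ := exists_reachable_rootRow b
    obtain ⟨h1, h2⟩ := rowIndex_eq_iff.mp (he'.trans ((show _ = _ from hab).trans hb'.symm))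
    exact (he.trans (reachable_of_row_eq h1 h2)).trans hb.symm
  have hrange : Set.range f = (rootRows (univ : Finset S.Box) : Set (Fin r × ℕ)) := by
    ext ρ
    constructor
    · rintro ⟨u, rfl⟩
      refine Quot.inductionOn u fun b => ?_
      obtain ⟨e, -, he, he'⟩ := exists_reachable_rootRow b
      change (b.1, rootRow S b.1 (row b)) ∈ _
      rw [← he]
      exact he'
    · intro hρ
      obtain ⟨a, ha, rfl⟩ := mem_image.mp (mem_coe.mp hρ)
      refine ⟨Quot.mk _ a, Prod.ext rfl ?_⟩
      change rootRow S a.1 (row a) = row a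
      have hroot := (mem_filter.mp ha).2
      cases hp : row a with
      | zero => rfl
      | succ p =>
        rw [rootRow, if_neg]
        rintro ⟨c, d, hcd, hd, hd'⟩
        exact hroot d (mem_univ _) (rowIndex_eq_iff.mpr ⟨hd, hd'.trans hp.symm⟩) c (mem_univ _) hcd
  rw [cc, ← Nat.card_range_of_injective hf, hrange]
  simp

theorem card_sharpCorners : S.sharpCorners.card = S.dullCorners.card + S.cc := by
  rw [← sharpIn_univ, ← dullIn_univ, isFilter_univ.card_sharpIn, card_rootRows_univ]

theorem cc_pos (hn : 0 < S.size) : 0 < S.cc := by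
  rw [← card_rootRows_univ]
  have : Nonempty S.Box := Fintype.card_pos_iff.mp hn
  exact (rootRows_nonempty univ_nonempty).card_pos

theorem IsFilter.card_dull_lt_card_sharp {A : Finset S.Box} (hA : IsFilter A)
    (hne : A.Nonempty) : (dullIn A).card < (sharpIn A).card := by
  rw [hA.card_sharpIn]
  exact Nat.lt_add_of_pos_right (rootRows_nonempty hne).card_pos

/-! ### Local weights of boxes and the product formula -/

theorem leftUnique_rowAdj : Relator.LeftUnique (RowAdj (S := S)) := by
  intro a a' b h h'
  obtain ⟨h1, h2, h3⟩ := h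
  obtain ⟨h4, h5, h6⟩ := h'
  exact box_ext (h1.trans h4.symm) (by omega) (by omega)

theorem leftUnique_colAdj : Relator.LeftUnique (ColAdj (S := S)) := by
  intro a a' b h h'
  obtain ⟨h1, h2, h3⟩ := h
  obtain ⟨h4, h5, h6⟩ := h'
  exact box_ext (h1.trans h4.symm) (by omega) (by omega)

theorem leftUnique_diagAdj : Relator.LeftUnique (DiagAdj (S := S)) := by
  intro a a' b h h'
  obtain ⟨h1, h2, h3⟩ := h
  obtain ⟨h4, h5, h6⟩ := h'
  exact box_ext (h1.trans h4.symm) (by omega) (by omega)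

variable {K : Type*}

open Classical in
/-- The value of `v` at the box of `A` that is `R`-related to `b`, or `u` if there is none. -/
noncomputable def nbrVal (A : Finset S.Box) (R : S.Box → S.Box → Prop) (b : S.Box)
    (v : S.Box → K) (u : K) : K :=
  if h : ∃ a ∈ A, R a b then v h.choose else u

theorem nbrVal_of_mem {A : Finset S.Box} {R : S.Box → S.Box → Prop} {a b : S.Box}
    (hR : Relator.LeftUnique R) (ha : a ∈ A) (h : R a b) (v : S.Box → K)
    (u : K) : nbrVal A R b v u = v a := by
  have hex : ∃ a ∈ A, R a b := ⟨a, ha, h⟩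
  rw [nbrVal, dif_pos hex, hR hex.choose_spec.2 h]

theorem nbrVal_of_not {A : Finset S.Box} {R : S.Box → S.Box → Prop} {b : S.Box}
    (h : ¬ ∃ a ∈ A, R a b) (v : S.Box → K) (u : K) : nbrVal A R b v u = u := by
  rw [nbrVal, dif_neg h]

/-- A neighbour lost by erasing `s` can only be `s`, and the default `v s` restores its value. This
is why the induction sets `y = x s`. -/
theorem nbrVal_erase (A : Finset S.Box) {R : S.Box → S.Box → Prop}
    (hR : Relator.LeftUnique R) (s b : S.Box) (v : S.Box → K) :
    nbrVal (A.erase s) R b v (v s) = nbrVal A R b v (v s) := by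
  by_cases h : ∃ a ∈ A.erase s, R a b
  · obtain ⟨a, ha, hab⟩ := h
    rw [nbrVal_of_mem hR ha hab, nbrVal_of_mem hR (mem_erase.mp ha).2 hab]
  · rw [nbrVal_of_not h]
    by_cases h' : ∃ a ∈ A, R a b
    · obtain ⟨a, ha, hab⟩ := h'
      have has : a = s := by
        by_contra hne
        exact h ⟨a, mem_erase.mpr ⟨hne, ha⟩, hab⟩
      rw [nbrVal_of_mem hR ha hab, has]
    · rw [nbrVal_of_not h']

variable [Field K]

theorem nbrVal_eq_mul (A : Finset S.Box) (R : S.Box → S.Box → Prop) (b : S.Box)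
    (v : S.Box → K) (u : K) :
    nbrVal A R b v u = nbrVal A R b v 1 * nbrVal A R b (fun _ => 1) u := by
  by_cases h : ∃ a ∈ A, R a b
  · simp [nbrVal, h]
  · simp [nbrVal, h]

theorem prod_pairs_eq_prod_nbrVal {R : S.Box → S.Box → Prop} [DecidableRel R]
    (hR : Relator.LeftUnique R) (g : S.Box → S.Box → K) :
    ∏ p : S.Box × S.Box with R p.1 p.2, g p.1 p.2 =
      ∏ b : S.Box, nbrVal univ R b (fun a => g a b) 1 := by
  rw [prod_filter, Fintype.prod_prod_type_right]
  refine prod_congr rfl fun b _ => ?_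
  by_cases h : ∃ a ∈ (univ : Finset S.Box), R a b
  · obtain ⟨a, ha, hab⟩ := h
    rw [nbrVal_of_mem hR ha hab, prod_eq_single a, if_pos hab]
    · intro a' _ hne
      exact if_neg fun h' => hne (hR h' hab)
    · exact fun h => absurd ha h
  · rw [nbrVal_of_not h]
    exact prod_eq_one fun a ha => if_neg fun hab => h ⟨a, ha, hab⟩

/-- A missing north or west neighbour forces a missing northwest one. The powers of `u` therefore
cancel unless all three are missing (sharp, `u⁻¹`) or only the northwest one is (dull, `u`). -/
theorem IsFilter.nbrVal_corner {A : Finset S.Box} (hA : IsFilter A) {b : S.Box} (hb : b ∈ A)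
    {u : K} (hu : u ≠ 0) :
    nbrVal A DiagAdj b (fun _ => 1) u /
        (nbrVal A ColAdj b (fun _ => 1) u * nbrVal A RowAdj b (fun _ => 1) u) =
      (if b ∈ dullIn A then u else 1) / (if b ∈ sharpIn A then u else 1) := by
  by_cases hc : ∃ a ∈ A, ColAdj a b
  · by_cases hr : ∃ a ∈ A, RowAdj a b
    · by_cases hd : ∃ a ∈ A, DiagAdj a b
      · rw [if_neg fun h => (mem_filter.mp h).2.2.2 hd, if_neg fun h => (mem_filter.mp h).2.1 hc]
        simp [nbrVal, hc, hr, hd]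
      · rw [if_pos (show b ∈ dullIn A from mem_filter.mpr ⟨hb, hr, hc, hd⟩), if_neg fun h => (mem_filter.mp h).2.1 hc]
        simp [nbrVal, hc, hr, hd]
    · have hd : ¬ ∃ a ∈ A, DiagAdj a b := fun ⟨a, ha, hab⟩ =>
        hr (hA.exists_rowAdj_of_diagAdj ha hab)
      rw [if_neg fun h => hr (mem_filter.mp h).2.1, if_neg fun h => (mem_filter.mp h).2.1 hc]
      simp [nbrVal, hc, hr, hd, hu]
  · have hd : ¬ ∃ a ∈ A, DiagAdj a b := fun ⟨a, ha, hab⟩ =>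
      hc (hA.exists_colAdj_of_diagAdj ha hab)
    rw [if_neg fun h => hc (mem_filter.mp h).2.2.1]
    by_cases hr : ∃ a ∈ A, RowAdj a b
    · rw [if_neg fun h => (mem_filter.mp h).2.2 hr]
      simp [nbrVal, hc, hr, hd, hu]
    · rw [if_pos (show b ∈ sharpIn A from mem_filter.mpr ⟨hb, hc, hr⟩)]
      simp [nbrVal, hc, hr, hd]

/-- The contribution of the box `b` to the product of the differences over adjacent pairs. -/
noncomputable def boxFactor (x : S.Box → K) (A : Finset S.Box) (b : S.Box) : K :=
  nbrVal A DiagAdj b (fun a => x b - x a) 1 /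
    (nbrVal A ColAdj b (fun a => x b - x a) 1 * nbrVal A RowAdj b (fun a => x b - x a) 1)

/-- The contribution of the box `b` when missing neighbours are given the value `y`. -/
noncomputable def boxWeight (x : S.Box → K) (A : Finset S.Box) (y : K) (b : S.Box) : K :=
  nbrVal A DiagAdj b (fun a => x b - x a) (x b - y) /
    (nbrVal A ColAdj b (fun a => x b - x a) (x b - y) *
      nbrVal A RowAdj b (fun a => x b - x a) (x b - y))

theorem IsFilter.boxWeight_eq {A : Finset S.Box} (hA : IsFilter A) (x : S.Box → K) {y : K}
    {b : S.Box} (hb : b ∈ A) (hy : x b ≠ y) :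
    boxWeight x A y b = boxFactor x A b *
      ((if b ∈ dullIn A then x b - y else 1) / (if b ∈ sharpIn A then x b - y else 1)) := by
  rw [← hA.nbrVal_corner hb (sub_ne_zero.mpr hy), boxWeight, boxFactor, nbrVal_eq_mul A DiagAdj,
    nbrVal_eq_mul A ColAdj, nbrVal_eq_mul A RowAdj, div_mul_div_comm]
  congr 1
  ring

theorem IsFilter.prod_boxWeight {A : Finset S.Box} (hA : IsFilter A) (x : S.Box → K) {y : K}
    (hy : ∀ b ∈ A, x b ≠ y) :
    ∏ b ∈ A, boxWeight x A y b = (∏ b ∈ A, boxFactor x A b) *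
      ((∏ d ∈ dullIn A, (x d - y)) / ∏ s ∈ sharpIn A, (x s - y)) := by
  rw [prod_congr rfl fun b hb => hA.boxWeight_eq x hb (hy b hb), prod_mul_distrib,
    prod_div_distrib, prod_ite_mem, prod_ite_mem,
    inter_eq_right.mpr (show dullIn A ⊆ A from filter_subset _ _),
    inter_eq_right.mpr (show sharpIn A ⊆ A from filter_subset _ _)]

/-- This is the partial fraction coefficient at `s`. The weights of the other boxes are unchanged by
the erasure, and `s` itself, having no neighbours to its north, west or northwest, has factor `1`.
-/
theorem IsFilter.prod_boxWeight_erase {A : Finset S.Box} (hA : IsFilter A) {x : S.Box → K}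
    (hx : Function.Injective x) {s : S.Box} (hs : s ∈ sharpIn A) :
    ∏ b ∈ A.erase s, boxWeight x (A.erase s) (x s) b = (∏ b ∈ A, boxFactor x A b) *
      ((∏ d ∈ dullIn A, (x d - x s)) / ∏ t ∈ (sharpIn A).erase s, (x t - x s)) := by
  obtain ⟨hsA, hcol, hrow⟩ := mem_filter.mp hs
  have hsd : s ∉ dullIn A := fun h => hrow (mem_filter.mp h).2.1
  have hdiag : ¬ ∃ a ∈ A, DiagAdj a s := fun ⟨a, ha, hab⟩ =>
    hcol (hA.exists_colAdj_of_diagAdj ha hab)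
  have hfac : boxFactor x A s = 1 := by
    rw [boxFactor, nbrVal_of_not hcol, nbrVal_of_not hrow, nbrVal_of_not hdiag]
    simp
  have hw : ∀ b ∈ A.erase s, boxWeight x (A.erase s) (x s) b = boxFactor x A b *
      ((if b ∈ dullIn A then x b - x s else 1) / (if b ∈ sharpIn A then x b - x s else 1)) := by
    intro b hb
    obtain ⟨hne, hbA⟩ := mem_erase.mp hb
    rw [← hA.boxWeight_eq x hbA (hx.ne hne), boxWeight,
      nbrVal_erase A leftUnique_diagAdj s b fun a => x b - x a,
      nbrVal_erase A leftUnique_colAdj s b fun a => x b - x a,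
      nbrVal_erase A leftUnique_rowAdj s b fun a => x b - x a, boxWeight]
  have h1 : A.erase s ∩ dullIn A = dullIn A := by
    refine inter_eq_right.mpr fun d hd => mem_erase.mpr ⟨?_, (mem_filter.mp hd).1⟩
    rintro rfl
    exact hsd hd
  have h2 : A.erase s ∩ sharpIn A = (sharpIn A).erase s := by
    rw [erase_inter, inter_eq_right.mpr (show sharpIn A ⊆ A from filter_subset _ _)]
  rw [prod_congr rfl hw, prod_mul_distrib, prod_div_distrib, prod_ite_mem, prod_ite_mem, h1, h2,
    ← mul_prod_erase A _ hsA, hfac, one_mul]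

theorem IsFilter.chainSum_eq (x : S.Box → K) (hx : Function.Injective x) (n : ℕ)
    {A : Finset S.Box} (hA : IsFilter A) (hn : A.card = n) (y : K) (hy : ∀ b ∈ A, x b ≠ y) :
    chainSum Precedes x n A y = ∏ b ∈ A, boxWeight x A y b := by
  classical
  induction n generalizing A y with
  | zero =>
    obtain rfl := card_eq_zero.mp hn
    rw [chainSum_zero, prod_empty]
  | succ n ih =>
    have hne : A.Nonempty := card_pos.mp (by omega)
    rw [chainSum_succ not_precedes_self, hA.filter_minimal, hA.prod_boxWeight x hy,
      prod_sub_div_prod_sub_eq_sum _ _ x hx.injOn (hA.card_dull_lt_card_sharp hne) y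
        fun s hs => hy s (mem_filter.mp hs).1, mul_sum]
    refine sum_congr rfl fun s hs => ?_
    have hsA := (mem_filter.mp hs).1
    rw [ih (hA.erase hs) (by rw [card_erase_of_mem hsA, hn]; rfl) (x s)
      (fun b hb => hx.ne (mem_erase.mp hb).1), hA.prod_boxWeight_erase hx hs]
    ring

/-! ### Sums over standard tableaux -/

theorem isStandard_iff {T : Fin S.size ≃ S.Box} :
    IsStandard T ↔ ∀ a b, Precedes a b → T.symm a < T.symm b := by
  constructor
  · rintro ⟨h1, h2⟩ a b ⟨h, h' | h'⟩
    · exact h1 a b h h'.1 h'.2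
    · exact h2 a b h h'.1 h'.2
  · exact fun H => ⟨fun a b h h1 h2 => H a b ⟨h, Or.inl ⟨h1, h2⟩⟩,
      fun a b h h1 h2 => H a b ⟨h, Or.inr ⟨h1, h2⟩⟩⟩

theorem sum_standardTableau (m : ℕ) (hm : S.size = m + 1) (g : (Fin (m + 1) → S.Box) → K) :
    ∑ T : S.StandardTableau, g (T.1 ∘ Fin.cast hm.symm) =
      open Classical in
      ∑ f : Fin (m + 1) → S.Box, if IsLinearExtension Precedes univ f then g f else 0 := by
  classical
  rw [← sum_filter]
  refine sum_bij (fun T _ => T.1 ∘ Fin.cast hm.symm) (fun T _ => ?_) (fun T _ T' _ h => ?_)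
    (fun f hf => ?_) fun _ _ => rfl
  · refine mem_filter.mpr ⟨mem_univ _, T.1.injective.comp (Fin.cast_injective _), fun a => ?_,
      fun i j h => ?_⟩
    · exact ⟨fun _ => ⟨Fin.cast hm (T.1.symm a), by simp⟩, fun _ => mem_univ _⟩
    · simpa using isStandard_iff.mp T.2 _ _ h
  · refine Subtype.ext (Equiv.ext fun i => ?_)
    simpa using congrFun h (Fin.cast hm i)
  · obtain ⟨-, hinj, hsurj, hlt⟩ := mem_filter.mp hf
    let e : Fin (m + 1) ≃ S.Box :=
      Equiv.ofBijective f ⟨hinj, fun a => (hsurj a).1 (mem_univ a)⟩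
    refine ⟨⟨(finCongr hm).trans e, isStandard_iff.mpr fun a b h => ?_⟩, mem_univ _, ?_⟩
    · have := hlt (e.symm a) (e.symm b) (by
        rw [show f (e.symm a) = a from e.apply_symm_apply a,
          show f (e.symm b) = b from e.apply_symm_apply b]
        exact h)
      simpa using this
    · rfl

/-- Since `1 - u / v = (v - u) / v`, the numerators collect `x b` for every box but the first,
whence the extra inverse. Writing `x ^ k * x⁻¹` keeps `k = 0` included. -/
theorem tableauDelta_eq (hn : 0 < S.size) {x : S.Box → K} (hx0 : ∀ b, x b ≠ 0) (q : K) (k m : ℕ)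
    (hm : S.size = m + 1) (T : S.StandardTableau) :
    tableauDelta hn x q k T = (q - q⁻¹) ^ m * (∏ b, x b) *
      ((x ((T.1 ∘ Fin.cast hm.symm) 0) ^ k * (x ((T.1 ∘ Fin.cast hm.symm) 0))⁻¹) *
        ∏ i : Fin m, (x ((T.1 ∘ Fin.cast hm.symm) i.succ) -
          x ((T.1 ∘ Fin.cast hm.symm) i.castSucc))⁻¹) := by
  set f : Fin (m + 1) → S.Box := T.1 ∘ Fin.cast hm.symm with hf
  have hprod : ∏ b, x b = x (f 0) * ∏ i : Fin m, x (f i.succ) := by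
    rw [← Fin.prod_univ_succ (fun i => x (f i)), ← Equiv.prod_comp ((finCongr hm.symm).trans T.1)]
    rfl
  have hfac : ∀ u v : K, v ≠ 0 → (q - q⁻¹) / (1 - u * v⁻¹) = (q - q⁻¹) * (v * (v - u)⁻¹) := by
    intro u v hv
    rw [show 1 - u * v⁻¹ = (v - u) * v⁻¹ by rw [sub_mul, mul_inv_cancel₀ hv], div_eq_mul_inv,
      mul_inv, inv_inv]
    ring
  have hdelta : tableauDelta hn x q k T = x (f 0) ^ k *
      ∏ i : Fin m, ((q - q⁻¹) * (x (f i.succ) * (x (f i.succ) - x (f i.castSucc))⁻¹)) := by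
    rw [tableauDelta]
    congr 1
    refine Fintype.prod_equiv (finCongr (by omega)) _ _ fun i => ?_
    rw [hfac _ _ (hx0 _)]
    rfl
  rw [hdelta, hprod, prod_mul_distrib, prod_mul_distrib, prod_const, card_univ, Fintype.card_fin]
  have := hx0 (f 0)
  field_simp

theorem sum_tableauDelta (hn : 0 < S.size) {x : S.Box → K} (hx : Function.Injective x)
    (hx0 : ∀ b, x b ≠ 0) (q : K) (k : ℕ) :
    ∑ T : S.StandardTableau, tableauDelta hn x q k T =
      (q - q⁻¹) ^ (S.size - 1) * (∏ b, x b) * (∏ b, boxFactor x univ b) *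
        ∑ s ∈ S.sharpCorners, (x s ^ k * (x s)⁻¹) * ((∏ d ∈ S.dullCorners, (x d - x s)) /
          ∏ t ∈ S.sharpCorners.erase s, (x t - x s)) := by
  classical
  obtain ⟨m, hm⟩ : ∃ m, S.size = m + 1 := ⟨S.size - 1, by omega⟩
  rw [sum_congr rfl fun T _ => tableauDelta_eq hn hx0 q k m hm T, ← mul_sum,
    sum_standardTableau m hm fun f => (x (f 0) ^ k * (x (f 0))⁻¹) *
      ∏ i : Fin m, (x (f i.succ) - x (f i.castSucc))⁻¹,
    sum_linearExtension_succ not_precedes_self x (fun s => x s ^ k * (x s)⁻¹),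
    isFilter_univ.filter_minimal, show S.size - 1 = m by omega, mul_assoc _ (∏ b, boxFactor x _ b),
    ← sharpIn_univ, ← dullIn_univ, mul_sum (sharpIn _) _ (∏ b, boxFactor x _ b)]
  congr 1
  refine sum_congr rfl fun s hs => ?_
  rw [(isFilter_univ.erase hs).chainSum_eq x hx m
    (by rw [card_erase_of_mem (mem_univ s), card_univ]; exact (congrArg (· - 1) hm))
    (x s) (fun b hb => hx.ne (mem_erase.mp hb).1), isFilter_univ.prod_boxWeight_erase hx hs]
  ring

/-- Pairs are grouped by their second box `b`. Each row or column pair brings `x b * c` and each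
diagonal pair its inverse; `nbrVal_corner` with `u = x b * c` corrects for missing neighbours, so
only corners deviate from one `x b * c` per box. -/
theorem prod_adjacent_pairs {x : S.Box → K} (hx0 : ∀ b, x b ≠ 0) {c : K} (hc : c ≠ 0) :
    (∏ p ∈ S.diagPairs, (1 - x p.1 * (x p.2)⁻¹) / c) *
        (∏ p ∈ S.rowPairs, c / (1 - x p.1 * (x p.2)⁻¹)) *
        (∏ p ∈ S.colPairs, c / (1 - x p.1 * (x p.2)⁻¹)) =
      (∏ b, boxFactor x univ b) * (∏ b, x b * c) *
        ((∏ d ∈ S.dullCorners, x d * c) / ∏ s ∈ S.sharpCorners, x s * c) := by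
  rw [diagPairs, rowPairs, colPairs,
    prod_pairs_eq_prod_nbrVal leftUnique_diagAdj fun a b => (1 - x a * (x b)⁻¹) / c,
    prod_pairs_eq_prod_nbrVal leftUnique_rowAdj fun a b => c / (1 - x a * (x b)⁻¹),
    prod_pairs_eq_prod_nbrVal leftUnique_colAdj fun a b => c / (1 - x a * (x b)⁻¹),
    ← prod_mul_distrib, ← prod_mul_distrib, ← prod_mul_distrib, ← sharpIn_univ, ← dullIn_univ,
    ← Finset.univ_inter (dullIn univ), ← Finset.univ_inter (sharpIn univ), ← prod_ite_mem,
    ← prod_ite_mem, ← prod_div_distrib, ← prod_mul_distrib]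
  refine prod_congr rfl fun b _ => ?_
  have hxb : x b ≠ 0 := hx0 b
  have hu : x b * c ≠ 0 := mul_ne_zero (hx0 b) hc
  rw [← isFilter_univ.nbrVal_corner (mem_univ b) hu, boxFactor]
  have hsub : ∀ a, 1 - x a * (x b)⁻¹ = (x b - x a) * (x b)⁻¹ := fun a => by
    rw [sub_mul, mul_inv_cancel₀ (hx0 b)]
  have hdiv : ∀ R : S.Box → S.Box → Prop,
      nbrVal univ R b (fun a => c / (1 - x a * (x b)⁻¹)) 1 =
        (x b * c) * ((nbrVal univ R b (fun a => x b - x a) 1)⁻¹ *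
          (nbrVal univ R b (fun _ => 1) (x b * c))⁻¹) := by
    intro R
    by_cases h : ∃ a ∈ univ, R a b
    · rw [nbrVal, dif_pos h, nbrVal, dif_pos h, nbrVal, dif_pos h, hsub, div_eq_mul_inv, mul_inv,
        inv_inv]
      ring
    · rw [nbrVal_of_not h, nbrVal_of_not h, nbrVal_of_not h]
      field_simp
  have hmul : nbrVal univ DiagAdj b (fun a => (1 - x a * (x b)⁻¹) / c) 1 =
        (x b * c)⁻¹ * (nbrVal univ DiagAdj b (fun a => x b - x a) 1 *
          nbrVal univ DiagAdj b (fun _ => 1) (x b * c)) := by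
    by_cases h : ∃ a ∈ univ, DiagAdj a b
    · rw [nbrVal, dif_pos h, nbrVal, dif_pos h, nbrVal, dif_pos h, hsub, div_eq_mul_inv, mul_inv]
      ring
    · rw [nbrVal_of_not h, nbrVal_of_not h, nbrVal_of_not h]
      field_simp
  rw [hdiv, hdiv, hmul, div_eq_mul_inv, div_eq_mul_inv, mul_inv, mul_inv]
  field_simp

/-- The exponent of `c` in the product is `n + |DC| - |SC| = n - cc`, so the prefactor completes it
to `n - 1`. -/
theorem pow_cc_mul_prod_adjacent_pairs (hn : 0 < S.size) {x : S.Box → K} (hx0 : ∀ b, x b ≠ 0)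
    {c : K} (hc : c ≠ 0) :
    c ^ (S.cc - 1) * ((∏ p ∈ S.diagPairs, (1 - x p.1 * (x p.2)⁻¹) / c) *
        (∏ p ∈ S.rowPairs, c / (1 - x p.1 * (x p.2)⁻¹)) *
        (∏ p ∈ S.colPairs, c / (1 - x p.1 * (x p.2)⁻¹))) =
      c ^ (S.size - 1) * (∏ b, x b) * (∏ b, boxFactor x univ b) *
        ((∏ d ∈ S.dullCorners, x d) / ∏ s ∈ S.sharpCorners, x s) := by
  rw [prod_adjacent_pairs hx0 hc]
  simp only [prod_mul_distrib, prod_const]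
  rw [card_sharpCorners, card_univ, show Fintype.card S.Box = S.size from rfl]
  have hcc := cc_pos hn
  obtain ⟨m, hm⟩ : ∃ m, S.size = m + 1 := ⟨S.size - 1, by omega⟩
  obtain ⟨e, he⟩ : ∃ e, S.cc = e + 1 := ⟨S.cc - 1, by omega⟩
  rw [hm, he, Nat.add_sub_cancel, Nat.add_sub_cancel]
  have hs : ∏ s ∈ S.sharpCorners, x s ≠ 0 := prod_ne_zero_iff.mpr fun s _ => hx0 s
  field_simp
  ring

theorem sum_tableauDelta_zero (hn : 0 < S.size) {x : S.Box → K} (hx : Function.Injective x)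
    (hx0 : ∀ b, x b ≠ 0) {q : K} (hq : q - q⁻¹ ≠ 0) :
    ∑ T : S.StandardTableau, tableauDelta hn x q 0 T =
      (q - q⁻¹) ^ (S.cc - 1) *
        (∏ p ∈ S.diagPairs, (1 - x p.1 * (x p.2)⁻¹) / (q - q⁻¹)) *
        (∏ p ∈ S.rowPairs, (q - q⁻¹) / (1 - x p.1 * (x p.2)⁻¹)) *
        (∏ p ∈ S.colPairs, (q - q⁻¹) / (1 - x p.1 * (x p.2)⁻¹)) := by
  have hlt : S.dullCorners.card < S.sharpCorners.card := by
    have := cc_pos hn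
    rw [card_sharpCorners]
    omega
  -- At `y = 0` the factor `(x s - y)⁻¹` is exactly the `(x s)⁻¹` left over when `k = 0`.
  have key := prod_sub_div_prod_sub_eq_sum S.dullCorners S.sharpCorners x hx.injOn hlt 0
    fun s _ => hx0 s
  simp only [sub_zero] at key
  rw [sum_tableauDelta hn hx hx0, mul_assoc ((q - q⁻¹) ^ (S.cc - 1)),
    mul_assoc ((q - q⁻¹) ^ (S.cc - 1)), pow_cc_mul_prod_adjacent_pairs hn hx0 hq, key]
  simp only [pow_zero, one_mul]

theorem sum_tableauDelta_pos (hn : 0 < S.size) {x : S.Box → K} (hx : Function.Injective x)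
    (hx0 : ∀ b, x b ≠ 0) {q : K} (hq : q - q⁻¹ ≠ 0) {k : ℕ} (hk : 1 ≤ k) :
    ∑ T : S.StandardTableau, tableauDelta hn x q k T =
        (-q + q⁻¹) ^ (S.cc - 1) *
          (∏ s ∈ S.sharpCorners, x s) * (∏ d ∈ S.dullCorners, (x d)⁻¹) *
          (∑ t ∈ Finset.range (S.dullCorners.card + 1),
            (-1) ^ t * elemSymm S.dullCorners x t *
              homogSymm S.sharpCorners x ((k : ℤ) - (t : ℤ) - (S.cc : ℤ))) *
          (∏ p ∈ S.diagPairs, (1 - x p.1 * (x p.2)⁻¹) / (q - q⁻¹)) *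
          (∏ p ∈ S.rowPairs, (q - q⁻¹) / (1 - x p.1 * (x p.2)⁻¹)) *
          (∏ p ∈ S.colPairs, (q - q⁻¹) / (1 - x p.1 * (x p.2)⁻¹)) := by
  obtain ⟨j, rfl⟩ : ∃ j, k = j + 1 := ⟨k - 1, by omega⟩
  have key := sum_pow_mul_prod_sub_div_prod_sub S.dullCorners S.sharpCorners x hx.injOn S.cc
    (cc_pos hn) card_sharpCorners j
  have hpow : ∀ s, x s ^ (j + 1) * (x s)⁻¹ = x s ^ j := fun s => by
    rw [pow_succ, mul_inv_cancel_right₀ (hx0 s)]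
  have hs : ∏ s ∈ S.sharpCorners, x s ≠ 0 := prod_ne_zero_iff.mpr fun s _ => hx0 s
  have hd : ∏ d ∈ S.dullCorners, x d ≠ 0 := prod_ne_zero_iff.mpr fun d _ => hx0 d
  have hPi := pow_cc_mul_prod_adjacent_pairs hn hx0 hq
  have hneg : (-q + q⁻¹) ^ (S.cc - 1) = (-1) ^ (S.cc - 1) * (q - q⁻¹) ^ (S.cc - 1) := by
    rw [← mul_pow]
    congr 1
    ring
  rw [sum_tableauDelta hn hx hx0]
  simp only [hpow, Nat.cast_add, Nat.cast_one]
  rw [key, hneg, prod_inv_distrib]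
  generalize (∑ t ∈ Finset.range (S.dullCorners.card + 1), (-1) ^ t * elemSymm S.dullCorners x t *
    homogSymm S.sharpCorners x ((j : ℤ) + 1 - (t : ℤ) - (S.cc : ℤ))) = G
  -- The corner quotient and its inverse are inserted so that the left side of `hPi` can be
  -- recognised.
  have hrw : (q - q⁻¹) ^ (S.size - 1) * (∏ b, x b) * (∏ b, boxFactor x univ b) =
      ((∏ s ∈ S.sharpCorners, x s) * (∏ d ∈ S.dullCorners, x d)⁻¹) *
      ((q - q⁻¹) ^ (S.size - 1) * (∏ b, x b) * (∏ b, boxFactor x univ b) *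
        ((∏ d ∈ S.dullCorners, x d) / ∏ s ∈ S.sharpCorners, x s)) := by
    field_simp
  rw [hrw, ← hPi]
  ring

/-! ### Specialisation to the indeterminates -/

theorem boxVar_injective (F : Type*) [Field F] (S : SkewShape r) :
    Function.Injective (boxVar F S) := fun _ _ h =>
  Option.some_injective _ (MvPolynomial.X_injective (IsFractionRing.injective _ _ h))

theorem boxVar_ne_zero (F : Type*) [Field F] (S : SkewShape r) (b : S.Box) :
    boxVar F S b ≠ 0 := by
  rw [boxVar, Ne, IsFractionRing.to_map_eq_zero_iff]
  exact MvPolynomial.X_ne_zero _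

theorem qVar_sub_inv_ne_zero (F : Type*) [Field F] (S : SkewShape r) :
    qVar F S - (qVar F S)⁻¹ ≠ 0 := by
  have h0 : qVar F S ≠ 0 := by
    rw [qVar, Ne, IsFractionRing.to_map_eq_zero_iff]
    exact MvPolynomial.X_ne_zero _
  intro h
  have h1 : qVar F S * qVar F S = 1 := by
    nth_rewrite 2 [sub_eq_zero.mp h]
    exact mul_inv_cancel₀ h0
  rw [qVar, ← map_mul, ← map_one (algebraMap (MvPolynomial (Option S.Box) F) _)] at h1
  -- Comparing constant terms in `q * q = 1` gives `0 = 1`, in every characteristic.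
  have h2 := congrArg MvPolynomial.constantCoeff (IsFractionRing.injective _ _ h1)
  simp at h2

end SkewShape

end

theorem corollary4p14 (F : Type*) [Field F] (r : ℕ) (S : SkewShape r) (hn : 0 < S.size)
    (q : SkewShape.RationalField F S) (hq : q = SkewShape.qVar F S)
    (x : S.Box → SkewShape.RationalField F S) (hx : x = SkewShape.boxVar F S) :
    (∑ T : S.StandardTableau, SkewShape.tableauDelta hn x q 0 T =
      (q - q⁻¹) ^ (S.cc - 1) *
        (∏ p ∈ S.diagPairs, (1 - x p.1 * (x p.2)⁻¹) / (q - q⁻¹)) *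
        (∏ p ∈ S.rowPairs, (q - q⁻¹) / (1 - x p.1 * (x p.2)⁻¹)) *
        (∏ p ∈ S.colPairs, (q - q⁻¹) / (1 - x p.1 * (x p.2)⁻¹))) ∧
    ∀ k : ℕ, 1 ≤ k →
      ∑ T : S.StandardTableau, SkewShape.tableauDelta hn x q k T =
        (-q + q⁻¹) ^ (S.cc - 1) *
          (∏ s ∈ S.sharpCorners, x s) * (∏ d ∈ S.dullCorners, (x d)⁻¹) *
          (∑ t ∈ Finset.range (S.dullCorners.card + 1),
            (-1) ^ t * elemSymm S.dullCorners x t *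
              homogSymm S.sharpCorners x ((k : ℤ) - (t : ℤ) - (S.cc : ℤ))) *
          (∏ p ∈ S.diagPairs, (1 - x p.1 * (x p.2)⁻¹) / (q - q⁻¹)) *
          (∏ p ∈ S.rowPairs, (q - q⁻¹) / (1 - x p.1 * (x p.2)⁻¹)) *
          (∏ p ∈ S.colPairs, (q - q⁻¹) / (1 - x p.1 * (x p.2)⁻¹)) := by
  subst hq hx
  exact ⟨SkewShape.sum_tableauDelta_zero hn (SkewShape.boxVar_injective F S)
      (SkewShape.boxVar_ne_zero F S) (SkewShape.qVar_sub_inv_ne_zero F S),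
    fun _ hk => SkewShape.sum_tableauDelta_pos hn (SkewShape.boxVar_injective F S)
      (SkewShape.boxVar_ne_zero F S) (SkewShape.qVar_sub_inv_ne_zero F S) hk⟩
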